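/- **Setting.** Let $\mathcal C_{TCM}$ be the category of topos causal models: an object is a triple $M=\langle U,V,F\rangle$ of sets $U$ (exogenous), $V$ (endogenous) and a function $F:U\to V$; an arrow $\langle U,V,F\rangle\to\langle U',V',F'\rangle$ is a pair of functions $h:U\to U'$, $g:V\to V'$ with $g\circ F=F'\circ h$. This category is a topos; its subobject classifier is $\mathrm{true}:\mathbf 1\to\Omega$ with $\Omega=(\{0,\tfrac12,1\}\to\{0,1\})$, $0\mapsto 0$, $\tfrac12\mapsto 1$, $1\mapsto 1$. The types of its Mitchell–Bénabou language are the objects of $\mathcal C_{TCM}$. Terms are built from typed variables by pairing $\langle\sigma,\tau\rangle$, equality $\sigma=\tau$, application $f\circ\sigma$ of arrows $f$ of $\mathcal C_{TCM}$, evaluation $\theta(\sigma)$, membership $\sigma\in\tau$, abstraction $\lambda x\,\sigma$, the connectives $\wedge,\vee,\Rightarrow,\neg$ and the quantifiers $\forall,\exists$. A term of type $A$ whose free variables are among variables of types $M_1,\dots,M_k$ ($k\ge1$) is interpreted in the usual way as an arrow $M_1\times\dots\times M_k\to A$, the logical symbols being interpreted by the internal Heyting algebra operations on $\Omega$ and by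 the internal quantifiers $\forall_B,\exists_B:\Omega^B\to\Omega$. Formulas are the terms of type $\Omega$. For a formula $\phi(x)$, with $x$ of type $M$ (or $x$ a list of variables and $M$ the product of their types), $\{x\mid\phi(x)\}$ is the subobject of $M$ classified by $\phi:M\to\Omega$; for a generalized element $\alpha:N\to M$, one writes $N\Vdash\phi(\alpha)$ if $\alpha$ factors through $\{x\mid\phi(x)\}$. **Theorem.** Let $\alpha:N\to M$ be a generalized element of $M$ in $\mathcal C_{TCM}$, let $\phi(x),\psi(x)$ be formulas with free variable $x$ of type $M$, and let $\chi(x,y)$ be a formula with free variables $x$ of type $M$ and $y$ of type $Y$. Then: 1. $N\Vdash\phi(\alpha)\wedge\psi(\alpha)$ if and only if $N\Vdash\phi(\alpha)$ and $N\Vdash\psi(\alpha)$. 2. $N\Vdash\phi(\alpha)\vee\psi(\alpha)$ if and only if there are arrows $p:O\to N$ and $q:P\to N$ such that the induced arrow $p+q:O+P\to N$ is epic, $O\Vdash\phi(\alpha p)$ and $P\Vdash\psi(\alpha q)$. 3. $N\Vdash\phi(\alpha)\Rightarrow\psi(\alpha)$ if and only if for every arrow $p:O\to N$ such that $O\Vdash\phi(\alpha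 p)$, also $O\Vdash\psi(\alpha p)$. 4. $N\Vdash\neg\phi(\alpha)$ if and only if for every arrow $p:O\to N$ such that $O\Vdash\phi(\alpha p)$, one has $O\cong\mathbf 0$ (the initial object). 5. $N\Vdash\exists y\,\chi(\alpha,y)$ if and only if there are an epic arrow $p:O\to N$ and a generalized element $\beta:O\to Y$ such that $O\Vdash\chi(\alpha p,\beta)$. 6. $N\Vdash\forall y\,\chi(\alpha,y)$ if and only if for every object $O$, every arrow $p:O\to N$ and every generalized element $\beta:O\to Y$, one has $O\Vdash\chi(\alpha p,\beta)$. -/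

import Mathlib

open CategoryTheory Limits MonoidalCategory CartesianMonoidalCategory

universe u

/-! ### The category of topos causal models -/

/-- A topos causal model `⟨U, V, F⟩`: exogenous values `U`, endogenous values `V`, and the
function `F : U → V` that determines the endogenous from the exogenous ones. -/
structure TCM : Type (u + 1) where
  U : Type u
  V : Type u
  F : U → V

namespace TCM

/-- An arrow of causal models is a commutative square. -/
@[ext]
structure Hom (M N : TCM.{u}) : Type u where
  onU : M.U → N.U
  onV : M.V → N.V
  comm : ∀ x, onV (M.F x) = N.F (onU x)

instance : Category TCM.{u} where
  Hom := Hom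
  id M := ⟨id, id, fun _ => rfl⟩
  comp f g := ⟨g.onU ∘ f.onU, g.onV ∘ f.onV, fun x => by simp [f.comm, g.comm]⟩

@[ext]
theorem hom_ext {M N : TCM.{u}} {f g : M ⟶ N} (hU : ∀ x, f.onU x = g.onU x)
    (hV : ∀ x, f.onV x = g.onV x) : f = g :=
  Hom.ext (funext hU) (funext hV)

@[simp]
theorem id_onU (M : TCM.{u}) (x : M.U) : Hom.onU (𝟙 M) x = x := rfl

@[simp]
theorem id_onV (M : TCM.{u}) (x : M.V) : Hom.onV (𝟙 M) x = x := rfl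

@[simp]
theorem comp_onU {L M N : TCM.{u}} (f : L ⟶ M) (g : M ⟶ N) (x : L.U) :
    (f ≫ g).onU x = g.onU (f.onU x) := rfl

@[simp]
theorem comp_onV {L M N : TCM.{u}} (f : L ⟶ M) (g : M ⟶ N) (x : L.V) :
    (f ≫ g).onV x = g.onV (f.onV x) := rfl

/-! ### Finite products, all limits and all colimits -/

/-- The terminal model, the identity of a one-point set. -/
def one : TCM.{u} := ⟨PUnit, PUnit, id⟩

def oneCone : LimitCone (Functor.empty.{0} TCM.{u}) where
  cone := asEmptyCone one
  isLimit := IsTerminal.ofUniqueHom (Y := one) (fun _ => ⟨fun _ => ⟨⟩, fun _ => ⟨⟩, fun _ => rfl⟩)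
    (fun _ _ => rfl)

/-- The product of two models, computed componentwise. -/
def prodObj (M N : TCM.{u}) : TCM.{u} := ⟨M.U × N.U, M.V × N.V, Prod.map M.F N.F⟩

def prodFst (M N : TCM.{u}) : prodObj M N ⟶ M := ⟨Prod.fst, Prod.fst, fun _ => rfl⟩

def prodSnd (M N : TCM.{u}) : prodObj M N ⟶ N := ⟨Prod.snd, Prod.snd, fun _ => rfl⟩

def prodLift {L M N : TCM.{u}} (f : L ⟶ M) (g : L ⟶ N) : L ⟶ prodObj M N :=
  ⟨fun x => (f.onU x, g.onU x), fun x => (f.onV x, g.onV x),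
    fun x => Prod.ext (f.comm x) (g.comm x)⟩

def prodCone (M N : TCM.{u}) : LimitCone (pair M N) where
  cone := BinaryFan.mk (prodFst M N) (prodSnd M N)
  isLimit := BinaryFan.isLimitMk (fun s => prodLift s.fst s.snd) (fun _ => rfl) (fun _ => rfl)
    (fun s m h₁ h₂ => by rw [← h₁, ← h₂]; rfl)

instance : CartesianMonoidalCategory TCM.{u} := .ofChosenFiniteProducts oneCone prodCone

def toArrow : TCM.{u} ⥤ Arrow (Type u) where
  obj M := Arrow.mk (↾M.F)
  map f := Arrow.homMk (↾f.onU) (↾f.onV) (by ext x; exact (f.comm x).symm)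

def ofArrow : Arrow (Type u) ⥤ TCM.{u} where
  obj f := ⟨f.left, f.right, f.hom⟩
  map s := ⟨s.left, s.right, fun x => (ConcreteCategory.congr_hom s.w x).symm⟩

/-- The category of topos causal models is the category of arrows of sets. -/
def equivArrow : TCM.{u} ≌ Arrow (Type u) where
  functor := toArrow
  inverse := ofArrow
  unitIso := NatIso.ofComponents (fun M => Iso.refl M)
  counitIso := NatIso.ofComponents (fun f => Iso.refl f)

instance : HasLimits TCM.{u} := Adjunction.has_limits_of_equivalence equivArrow.functor

instance : HasColimits TCM.{u} := Adjunction.has_colimits_of_equivalence equivArrow.functor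

/-! ### Monomorphisms and images -/

/-- The model with one endogenous and no exogenous value. -/
def dot : TCM.{u} := ⟨PEmpty, PUnit, PEmpty.elim⟩

def pointU {M : TCM.{u}} (x : M.U) : one ⟶ M := ⟨fun _ => x, fun _ => M.F x, fun _ => rfl⟩

def pointV {M : TCM.{u}} (x : M.V) : dot ⟶ M := ⟨PEmpty.elim, fun _ => x, fun y => y.elim⟩

theorem injective_onU {M N : TCM.{u}} (m : M ⟶ N) [Mono m] : Function.Injective m.onU := by
  intro x y h
  have : pointU x ≫ m = pointU y ≫ m := by
    ext z
    · exact h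
    · change m.onV (M.F x) = m.onV (M.F y)
      rw [m.comm, m.comm, h]
  exact congrArg (fun f => Hom.onU f PUnit.unit) ((cancel_mono m).1 this)

theorem injective_onV {M N : TCM.{u}} (m : M ⟶ N) [Mono m] : Function.Injective m.onV := by
  intro x y h
  have : pointV x ≫ m = pointV y ≫ m := by
    ext z
    · exact z.elim
    · exact h
  exact congrArg (fun f => Hom.onV f PUnit.unit) ((cancel_mono m).1 this)

theorem mono_of_injective {M N : TCM.{u}} (m : M ⟶ N) (hU : Function.Injective m.onU)
    (hV : Function.Injective m.onV) : Mono m where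
  right_cancellation f g h := by
    ext x
    · exact hU (congrArg (fun f => Hom.onU f x) h)
    · exact hV (congrArg (fun f => Hom.onV f x) h)

/-- A map into the target of a monomorphism that lands in its range, lifted to its source. -/
noncomputable def liftMono {L M N : TCM.{u}} (m : M ⟶ N) [Mono m] (f : L ⟶ N)
    (hU : ∀ x, ∃ y, m.onU y = f.onU x) (hV : ∀ x, ∃ y, m.onV y = f.onV x) : L ⟶ M where
  onU x := (hU x).choose
  onV x := (hV x).choose
  comm x := injective_onV m (by
    rw [(hV _).choose_spec, m.comm, (hU x).choose_spec, f.comm])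

theorem liftMono_comp {L M N : TCM.{u}} (m : M ⟶ N) [Mono m] (f : L ⟶ N)
    (hU : ∀ x, ∃ y, m.onU y = f.onU x) (hV : ∀ x, ∃ y, m.onV y = f.onV x) :
    liftMono m f hU hV ≫ m = f := by
  ext x
  · exact (hU x).choose_spec
  · exact (hV x).choose_spec

def range {M N : TCM.{u}} (f : M ⟶ N) : TCM.{u} :=
  ⟨Set.range f.onU, Set.range f.onV, fun y => ⟨N.F y, by
    obtain ⟨_, x, rfl⟩ := y; exact ⟨M.F x, f.comm x⟩⟩⟩

def rangeι {M N : TCM.{u}} (f : M ⟶ N) : range f ⟶ N :=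
  ⟨Subtype.val, Subtype.val, fun _ => rfl⟩

instance {M N : TCM.{u}} (f : M ⟶ N) : Mono (rangeι f) :=
  mono_of_injective _ Subtype.val_injective Subtype.val_injective

def rangeFactor {M N : TCM.{u}} (f : M ⟶ N) : MonoFactorisation f where
  I := range f
  m := rangeι f
  e := ⟨fun x => ⟨_, x, rfl⟩, fun x => ⟨_, x, rfl⟩, fun x => Subtype.ext (f.comm x)⟩

instance : HasImages TCM.{u} where
  has_image f := HasImage.mk
    { F := rangeFactor f
      isImage :=
        { lift := fun F' => liftMono F'.m (rangeι f)
            (fun y => by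
              obtain ⟨_, x, rfl⟩ := y
              exact ⟨F'.e.onU x, congrArg (fun f => Hom.onU f x) F'.fac⟩)
            (fun y => by
              obtain ⟨_, x, rfl⟩ := y
              exact ⟨F'.e.onV x, congrArg (fun f => Hom.onV f x) F'.fac⟩)
          lift_fac := fun _ => liftMono_comp _ _ _ _ } }

def zero : TCM.{u} := ⟨PEmpty, PEmpty, PEmpty.elim⟩

def zeroIsInitial : IsInitial zero.{u} :=
  IsInitial.ofUniqueHom (fun _ => ⟨PEmpty.elim, PEmpty.elim, fun x => x.elim⟩)
    (fun _ _ => by ext x <;> exact x.elim)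

instance : InitialMonoClass TCM.{u} :=
  InitialMonoClass.of_isInitial zeroIsInitial fun _ =>
    mono_of_injective _ (fun x => x.elim) (fun x => x.elim)

/-! ### Exponentials -/

/-- The exponential `N ^ M`: exogenous values are the arrows `M ⟶ N`, endogenous values are the
functions from `M.V` to `N.V`. -/
def expObj (M N : TCM.{u}) : TCM.{u} := ⟨M ⟶ N, M.V → N.V, Hom.onV⟩

def expEquiv (M L N : TCM.{u}) : (M ⊗ L ⟶ N) ≃ (L ⟶ expObj M N) where
  toFun f :=
    { onU := fun y =>
        { onU := fun x => f.onU (x, y)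
          onV := fun x => f.onV (x, L.F y)
          comm := fun x => f.comm (x, y) }
      onV := fun y x => f.onV (x, y)
      comm := fun _ => rfl }
  invFun g :=
    { onU := fun z => (g.onU z.2).onU z.1
      onV := fun z => g.onV z.2 z.1
      comm := fun z => (congrFun (g.comm z.2) (M.F z.1)).trans ((g.onU z.2).comm z.1) }
  left_inv _ := rfl
  right_inv g := by
    ext y
    · refine Hom.ext rfl (funext fun x => ?_)
      exact congrFun (g.comm y) x
    · rfl

instance : MonoidalClosed TCM.{u} where
  closed M :=
    { rightAdj := Adjunction.rightAdjointOfEquiv (F := tensorLeft M) (G_obj := expObj M)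
        (expEquiv M) (fun L' L N f g => by
          ext y
          · exact Hom.ext rfl (funext fun x => congrArg (fun z => Hom.onV g (x, z)) (f.comm y))
          · rfl)
      adj := Adjunction.adjunctionOfEquivRight _ _ }

/-! ### The subobject classifier -/

/-- The truth values `0`, `½`, `1`. -/
inductive Three : Type u
  | zero | half | one

/-- The truth values `0`, `1`. -/
inductive Two : Type u
  | zero | one

/-- The object of truth values `{0, ½, 1} → {0, 1}`, with `0 ↦ 0`, `½ ↦ 1`, `1 ↦ 1`. -/
abbrev Omega : TCM.{u} :=
  ⟨Three, Two, fun | .zero => .zero | .half => .one | .one => .one⟩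

def trueΩ : 𝟙_ TCM.{u} ⟶ Omega := ⟨fun _ => .one, fun _ => .one, fun _ => rfl⟩

open Classical in
/-- The characteristic arrow of a monomorphism `m : S ⟶ X`. -/
noncomputable def char {S X : TCM.{u}} (m : S ⟶ X) [Mono m] : X ⟶ Omega where
  onU x := if x ∈ Set.range m.onU then .one else if X.F x ∈ Set.range m.onV then .half else .zero
  onV x := if x ∈ Set.range m.onV then .one else .zero
  comm x := by
    by_cases h : x ∈ Set.range m.onU
    · have h' : X.F x ∈ Set.range m.onV := by
        obtain ⟨y, rfl⟩ := h
        exact ⟨S.F y, m.comm y⟩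
      simp [h, h']
    · by_cases h' : X.F x ∈ Set.range m.onV <;> simp [h, h']

theorem char_onU_eq_one {S X : TCM.{u}} (m : S ⟶ X) [Mono m] (x : X.U) :
    (char m).onU x = .one ↔ ∃ y, m.onU y = x := by
  classical
  change (if _ then _ else if _ then _ else _) = _ ↔ x ∈ Set.range m.onU
  split_ifs <;> simp_all

theorem char_onV_eq_one {S X : TCM.{u}} (m : S ⟶ X) [Mono m] (x : X.V) :
    (char m).onV x = .one ↔ ∃ y, m.onV y = x := by
  classical
  change (if _ then _ else _) = _ ↔ x ∈ Set.range m.onV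
  split_ifs <;> simp_all

theorem isPullback_char {S X : TCM.{u}} (m : S ⟶ X) [Mono m] :
    IsPullback m (isTerminalTensorUnit.from S) (char m) trueΩ := by
  refine ⟨⟨?_⟩, ⟨PullbackCone.IsLimit.mk _ (fun s => liftMono m s.fst ?_ ?_)
    (fun s => liftMono_comp _ _ _ _) (fun s => isTerminalTensorUnit.hom_ext _ _)
    (fun s f hf _ => ?_)⟩⟩
  · ext x
    · exact (char_onU_eq_one m _).2 ⟨x, rfl⟩
    · exact (char_onV_eq_one m _).2 ⟨x, rfl⟩
  · exact fun x => (char_onU_eq_one m _).1 (congrArg (fun f => Hom.onU f x) s.condition)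
  · exact fun x => (char_onV_eq_one m _).1 (congrArg (fun f => Hom.onV f x) s.condition)
  · rw [← cancel_mono m, hf, liftMono_comp]

theorem eq_char {S X : TCM.{u}} (m : S ⟶ X) [Mono m] (c : X ⟶ Omega)
    (h : IsPullback m (isTerminalTensorUnit.from S) c trueΩ) : c = char m := by
  have hU : ∀ x, c.onU x = .one ↔ ∃ y, m.onU y = x := by
    refine fun x => ⟨fun hx => ?_, ?_⟩
    · have w : pointU x ≫ c = isTerminalTensorUnit.from one ≫ trueΩ := by
        ext z
        · exact hx
        · change c.onV (X.F x) = .one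
          rw [c.comm, hx]
      exact ⟨(h.lift _ _ w).onU ⟨⟩, congrArg (fun f : one ⟶ X => Hom.onU f PUnit.unit) (h.lift_fst _ _ w)⟩
    · rintro ⟨y, rfl⟩
      exact congrArg (fun f => Hom.onU f y) h.w
  have hV : ∀ x, c.onV x = .one ↔ ∃ y, m.onV y = x := by
    refine fun x => ⟨fun hx => ?_, ?_⟩
    · have w : pointV x ≫ c = isTerminalTensorUnit.from dot ≫ trueΩ := by
        ext z
        · exact z.elim
        · exact hx
      exact ⟨(h.lift _ _ w).onV ⟨⟩, congrArg (fun f : dot ⟶ X => Hom.onV f PUnit.unit) (h.lift_fst _ _ w)⟩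
    · rintro ⟨y, rfl⟩
      exact congrArg (fun f => Hom.onV f y) h.w
  have eV : ∀ x, c.onV x = (char m).onV x := by
    intro x
    have := (hV x).trans (char_onV_eq_one m x).symm
    generalize c.onV x = a at *
    generalize (char m).onV x = b at *
    cases a <;> cases b <;> simp_all
  ext x
  · have h₁ := (hU x).trans (char_onU_eq_one m x).symm
    have h₂ : Omega.F (c.onU x) = Omega.F ((char m).onU x) := by
      rw [← c.comm, ← (char m).comm, eV]
    generalize c.onU x = a at *
    generalize (char m).onU x = b at *
    cases a <;> cases b <;> simp_all [Omega]
  · exact eV x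

/-- `trueΩ : 1 ⟶ Ω` is a subobject classifier. -/
noncomputable def classifier : Subobject.Classifier TCM.{u} :=
  .mkOfTerminalΩ₀ (𝟙_ TCM) isTerminalTensorUnit Omega trueΩ (fun m _ => char m)
    (fun m _ => isPullback_char m) (fun m _ c h => eq_char m c h)

instance : HasSubobjectClassifier TCM.{u} := ⟨⟨classifier⟩⟩

instance {X : TCM.{u}} (x : 𝟙_ TCM ⟶ X) : Mono x := isTerminalTensorUnit.mono_from x

/-- The characteristic arrow of a subobject. -/
noncomputable def charSub {X : TCM.{u}} (S : Subobject X) : X ⟶ Omega := char S.arrow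

/-- The subobject `{x | f x}` of `X` classified by `f : X ⟶ Ω`. -/
noncomputable def extension {X : TCM.{u}} (f : X ⟶ Omega) : Subobject X :=
  (Subobject.pullback f).obj (Subobject.mk trueΩ)

/-! ### The logical operations on `Ω` -/

/-- `∧ : Ω × Ω ⟶ Ω`, the meet of the two generic subobjects. -/
noncomputable def andΩ : Omega ⊗ Omega ⟶ Omega.{u} :=
  charSub (extension (fst Omega Omega) ⊓ extension (snd Omega Omega))

/-- `∨ : Ω × Ω ⟶ Ω`, the join of the two generic subobjects. -/
noncomputable def orΩ : Omega ⊗ Omega ⟶ Omega.{u} :=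
  charSub (extension (fst Omega Omega) ⊔ extension (snd Omega Omega))

/-- `⇒ : Ω × Ω ⟶ Ω`, the characteristic arrow of the order relation `{(a, b) | a ∧ b = a}`. -/
noncomputable def impΩ : Omega ⊗ Omega ⟶ Omega.{u} :=
  charSub (equalizerSubobject andΩ (fst Omega Omega))

/-- `false : 1 ⟶ Ω`, the characteristic arrow of the least subobject of `1`. -/
noncomputable def falseΩ : 𝟙_ TCM.{u} ⟶ Omega := charSub ⊥

/-- `¬ : Ω ⟶ Ω`, that is `a ↦ (a ⇒ false)`. -/
noncomputable def notΩ : Omega ⟶ Omega.{u} := lift (𝟙 Omega) (toUnit Omega ≫ falseΩ) ≫ impΩ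

instance (B : TCM.{u}) : Mono (lift (𝟙 B) (𝟙 B)) := mono_of_mono_fac (lift_fst (𝟙 B) (𝟙 B))

/-- Equality `δ : B × B ⟶ Ω`, the characteristic arrow of the diagonal. -/
noncomputable def eqΩ (B : TCM.{u}) : B ⊗ B ⟶ Omega := char (lift (𝟙 B) (𝟙 B))

/-- The power object `Ω ^ B`. -/
noncomputable abbrev power (B : TCM.{u}) : TCM.{u} := (ihom B).obj Omega

/-- Membership `B × Ω ^ B ⟶ Ω`. -/
noncomputable def memΩ (B : TCM.{u}) : B ⊗ power B ⟶ Omega := (ihom.ev B).app Omega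

/-- `∀ : Ω ^ B ⟶ Ω`, the characteristic arrow of the name `1 ⟶ Ω ^ B` of the maximal subobject
of `B`. -/
noncomputable def allΩ (B : TCM.{u}) : power B ⟶ Omega :=
  char (MonoidalClosed.curry (toUnit (B ⊗ 𝟙_ TCM) ≫ trueΩ))

/-- `∃ : Ω ^ B ⟶ Ω`, the characteristic arrow of the image of the membership relation
`{(b, S) | b ∈ S}` under the projection `B × Ω ^ B ⟶ Ω ^ B`. -/
noncomputable def exΩ (B : TCM.{u}) : power B ⟶ Omega :=
  charSub (imageSubobject ((extension (memΩ B)).arrow ≫ snd B (power B)))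

end TCM

/-! ### The Mitchell–Bénabou language -/

/-- A non-empty list of variables with their types, the types being causal models. A closed
formula is one in the context of a single dummy variable of type `1`. -/
inductive Ctx : Type (u + 1)
  | single (M : TCM.{u}) : Ctx
  | cons (B : TCM.{u}) (Γ : Ctx) : Ctx

/-- The product of the types of the variables. For one variable of type `M` it is `M` itself. -/
def Ctx.obj : Ctx.{u} → TCM.{u}
  | single M => M
  | cons B Γ => B ⊗ Γ.obj

theorem Ctx.obj_single (M : TCM.{u}) : (Ctx.single M).obj = M := rfl

/-- `Var Γ A` is the type of those variables of `Γ` that have type `A`. -/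
inductive Var : Ctx.{u} → TCM.{u} → Type (u + 1)
  | only (M : TCM.{u}) : Var (.single M) M
  | head (B : TCM.{u}) (Γ : Ctx.{u}) : Var (.cons B Γ) B
  | tail (B : TCM.{u}) {Γ : Ctx.{u}} {A : TCM.{u}} (x : Var Γ A) : Var (.cons B Γ) A

/-- `Term Γ A` is the type of the terms of type `A` with free variables in `Γ`. In `lam`, `all`
and `ex` the first variable of the longer context is the bound one. -/
inductive Term : Ctx.{u} → TCM.{u} → Type (u + 1)
  | var {Γ A} (x : Var Γ A) : Term Γ A
  | pair {Γ A B} (σ : Term Γ A) (τ : Term Γ B) : Term Γ (A ⊗ B)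
  | eq {Γ B} (σ τ : Term Γ B) : Term Γ TCM.Omega
  | app {Γ A B} (f : A ⟶ B) (σ : Term Γ A) : Term Γ B
  | eval {Γ B C} (θ : Term Γ ((ihom C).obj B)) (σ : Term Γ C) : Term Γ B
  | mem {Γ B} (σ : Term Γ B) (τ : Term Γ (TCM.power B)) : Term Γ TCM.Omega
  | lam {Γ B C} (σ : Term (.cons C Γ) B) : Term Γ ((ihom C).obj B)
  | and {Γ} (φ ψ : Term Γ TCM.Omega) : Term Γ TCM.Omega
  | or {Γ} (φ ψ : Term Γ TCM.Omega) : Term Γ TCM.Omega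
  | imp {Γ} (φ ψ : Term Γ TCM.Omega) : Term Γ TCM.Omega
  | not {Γ} (φ : Term Γ TCM.Omega) : Term Γ TCM.Omega
  | all {Γ B} (φ : Term (.cons B Γ) TCM.Omega) : Term Γ TCM.Omega
  | ex {Γ B} (φ : Term (.cons B Γ) TCM.Omega) : Term Γ TCM.Omega

/-- Formulas are terms of type `Ω`. -/
abbrev Formula (Γ : Ctx.{u}) : Type (u + 1) := Term Γ TCM.Omega

/-- A variable is interpreted by the identity, precomposed with a projection. -/
def Var.interp {Γ : Ctx.{u}} {A : TCM.{u}} : Var Γ A → (Γ.obj ⟶ A)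
  | .only M => 𝟙 M
  | .head B Γ => fst B Γ.obj
  | .tail B (Γ := Γ) x => snd B Γ.obj ≫ x.interp

/-- The interpretation of a term of type `A` in the context `Γ` as an arrow `Γ.obj ⟶ A`. -/
noncomputable def Term.interp {Γ : Ctx.{u}} {A : TCM.{u}} : Term Γ A → (Γ.obj ⟶ A)
  | .var x => x.interp
  | .pair σ τ => lift σ.interp τ.interp
  | .eq (B := B) σ τ => lift σ.interp τ.interp ≫ TCM.eqΩ B
  | .app f σ => σ.interp ≫ f
  | .eval (B := B) (C := C) θ σ => lift σ.interp θ.interp ≫ (ihom.ev C).app B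
  | .mem (B := B) σ τ => lift σ.interp τ.interp ≫ TCM.memΩ B
  | .lam σ => MonoidalClosed.curry σ.interp
  | .and φ ψ => lift φ.interp ψ.interp ≫ TCM.andΩ
  | .or φ ψ => lift φ.interp ψ.interp ≫ TCM.orΩ
  | .imp φ ψ => lift φ.interp ψ.interp ≫ TCM.impΩ
  | .not φ => φ.interp ≫ TCM.notΩ
  | .all (B := B) φ => MonoidalClosed.curry φ.interp ≫ TCM.allΩ B
  | .ex (B := B) φ => MonoidalClosed.curry φ.interp ≫ TCM.exΩ B

/-- `Forces α φ` is the forcing relation `N ⊩ φ(α)` at the generalized element `α : N ⟶ Γ.obj`: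
`α` factors through the subobject `{x | φ(x)}`. -/
def Forces {N : TCM.{u}} {Γ : Ctx.{u}} (α : N ⟶ Γ.obj) (φ : Formula Γ) : Prop :=
  (TCM.extension φ.interp).Factors α

/-! Forcing `φ` at `α` means that `α ≫ φ.interp` is constantly true (`forces_iff`), and composing
with the characteristic arrow of a subobject gives true exactly when the arrow factors through it
(`isTrue_comp_charSub_iff`). Each clause thus reduces to factoring through the subobject that
defines the connective or quantifier: a meet, a join, an equalizer, the least subobject, an image,
or the name of the maximal subobject.

Conjunction and implication are then formal, and universal quantification follows by transposing
along currying. Disjunction and existence need covers: truth can be tested after an epi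
(`factors_comp_iff_of_epi`), and conversely epis are recognised on points, since `one` and `dot`
generate the category and both lift through componentwise unions and images (`sup_factors_iff`,
`imageSubobject_factors_iff`). Negation is implication into `falseΩ`, where strictness of the
initial object enters. -/

namespace TCM

/-! ### Truth at a stage and factoring through subobjects -/

/-- A truth value at stage `N` is true if it is the constant arrow `true`. -/
def IsTrue {N : TCM.{u}} (f : N ⟶ Omega) : Prop := f = toUnit N ≫ trueΩ

theorem IsTrue.comp {N O : TCM.{u}} {f : N ⟶ Omega} (h : IsTrue f) (p : O ⟶ N) :
    IsTrue (p ≫ f) := by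
  unfold IsTrue at *
  rw [h, ← Category.assoc, toUnit_unique (p ≫ toUnit N) (toUnit O)]

theorem isTrue_comp_iff_of_epi {N O : TCM.{u}} (p : O ⟶ N) [Epi p] (f : N ⟶ Omega) :
    IsTrue (p ≫ f) ↔ IsTrue f := by
  refine ⟨fun h => ?_, fun h => h.comp p⟩
  unfold IsTrue at *
  rw [← cancel_epi p, h, ← Category.assoc, toUnit_unique (p ≫ toUnit N) (toUnit O)]

theorem mk_trueΩ_factors_iff {N : TCM.{u}} (f : N ⟶ Omega) :
    (Subobject.mk trueΩ).Factors f ↔ IsTrue f := by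
  constructor
  · rintro ⟨t, ht⟩
    exact ht.symm.trans (congrArg (· ≫ trueΩ) (toUnit_unique t (toUnit N)))
  · exact fun h => ⟨toUnit N, h.symm⟩

theorem extension_factors_iff {N X : TCM.{u}} (f : X ⟶ Omega) (a : N ⟶ X) :
    (extension f).Factors a ↔ IsTrue (a ≫ f) :=
  (pullback_factors_iff f _ a).trans (mk_trueΩ_factors_iff _)

theorem isTrue_comp_char_iff {N S X : TCM.{u}} (m : S ⟶ X) [Mono m] (a : N ⟶ X) :
    IsTrue (a ≫ char m) ↔ ∃ s : N ⟶ S, s ≫ m = a := by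
  constructor
  · intro h
    exact ⟨(isPullback_char m).lift a (toUnit N) h, (isPullback_char m).lift_fst _ _ _⟩
  · rintro ⟨s, rfl⟩
    rw [Category.assoc]
    refine IsTrue.comp ?_ s
    exact (isPullback_char m).w.trans
      (congrArg (· ≫ trueΩ) (toUnit_unique (isTerminalTensorUnit.from S) (toUnit S)))

theorem isTrue_comp_charSub_iff {N X : TCM.{u}} (S : Subobject X) (a : N ⟶ X) :
    IsTrue (a ≫ charSub S) ↔ S.Factors a := by
  rw [charSub, isTrue_comp_char_iff]
  exact ⟨fun ⟨s, hs⟩ => hs ▸ Subobject.factors_comp_arrow s,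
    fun h => ⟨S.factorThru a h, S.factorThru_arrow a h⟩⟩

/-- Factoring through `S` is an equation between arrows into `Ω`, so an epi cancels. This gives the
passage from a cover back to `N` for joins and images. -/
theorem factors_comp_iff_of_epi {N O X : TCM.{u}} (S : Subobject X) (p : O ⟶ N) [Epi p]
    (a : N ⟶ X) : S.Factors (p ≫ a) ↔ S.Factors a := by
  rw [← isTrue_comp_charSub_iff, ← isTrue_comp_charSub_iff, Category.assoc,
    isTrue_comp_iff_of_epi]

/-! ### Generation by points -/

/-- Arrows from `one` are the exogenous elements and arrows from `dot` the endogenous ones, so these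
two objects generate. -/
theorem hom_ext_of_points {M N : TCM.{u}} {f g : M ⟶ N}
    (hU : ∀ x, pointU x ≫ f = pointU x ≫ g) (hV : ∀ x, pointV x ≫ f = pointV x ≫ g) :
    f = g := by
  ext x
  · exact congrArg (fun k : one ⟶ N => k.onU PUnit.unit) (hU x)
  · exact congrArg (fun k : dot ⟶ N => k.onV PUnit.unit) (hV x)

theorem pointU_comp {M N : TCM.{u}} (f : M ⟶ N) (x : M.U) :
    pointU x ≫ f = pointU (f.onU x) := by
  ext z
  · rfl
  · exact f.comm x

theorem pointV_comp {M N : TCM.{u}} (f : M ⟶ N) (x : M.V) :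
    pointV x ≫ f = pointV (f.onV x) := by
  ext z
  · exact z.elim
  · rfl

theorem isTrue_pointU_iff (a : Omega.{u}.U) : IsTrue (pointU a) ↔ a = .one := by
  constructor
  · exact fun h => congrArg (fun k : one ⟶ Omega => k.onU PUnit.unit) h
  · rintro rfl
    ext <;> rfl

theorem isTrue_pointV_iff (a : Omega.{u}.V) : IsTrue (pointV a) ↔ a = .one := by
  constructor
  · exact fun h => congrArg (fun k : dot ⟶ Omega => k.onV PUnit.unit) h
  · rintro rfl
    ext z
    · exact z.elim
    · rfl

/-- Truth values are determined by the stages at which they become true. -/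
theorem omega_hom_ext {N : TCM.{u}} {f g : N ⟶ Omega}
    (h : ∀ (O : TCM.{u}) (p : O ⟶ N), IsTrue (p ≫ f) ↔ IsTrue (p ≫ g)) : f = g := by
  have hV : ∀ x, f.onV x = g.onV x := by
    intro x
    have := h _ (pointV x)
    rw [pointV_comp, pointV_comp, isTrue_pointV_iff, isTrue_pointV_iff] at this
    generalize f.onV x = a at *
    generalize g.onV x = b at *
    cases a <;> cases b <;> simp_all
  ext x
  · have h₁ := h _ (pointU x)
    rw [pointU_comp, pointU_comp, isTrue_pointU_iff, isTrue_pointU_iff] at h₁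
    -- Truth at an exogenous point does not separate `0` from `½`; their endogenous images do.
    have h₂ : Omega.F (f.onU x) = Omega.F (g.onU x) := by rw [← f.comm, ← g.comm, hV]
    generalize f.onU x = a at *
    generalize g.onU x = b at *
    cases a <;> cases b <;> simp_all [Omega]
  · exact hV x

theorem epi_of_lift_points {O N : TCM.{u}} (p : O ⟶ N)
    (hU : ∀ x : N.U, ∃ s : one ⟶ O, s ≫ p = pointU x)
    (hV : ∀ x : N.V, ∃ s : dot ⟶ O, s ≫ p = pointV x) : Epi p where
  left_cancellation f g h := hom_ext_of_points
    (fun x => by obtain ⟨s, hs⟩ := hU x; rw [← hs, Category.assoc, h, Category.assoc])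
    (fun x => by obtain ⟨s, hs⟩ := hV x; rw [← hs, Category.assoc, h, Category.assoc])

/-! ### Unions, images and the least subobject -/

/-- The union of two subobjects, computed componentwise. -/
def union {X : TCM.{u}} (A B : Subobject X) : TCM.{u} where
  U := ↥(Set.range A.arrow.onU ∪ Set.range B.arrow.onU)
  V := ↥(Set.range A.arrow.onV ∪ Set.range B.arrow.onV)
  F y := ⟨X.F y, by
    obtain ⟨_, ⟨x, rfl⟩ | ⟨x, rfl⟩⟩ := y
    · exact .inl ⟨_, A.arrow.comm x⟩
    · exact .inr ⟨_, B.arrow.comm x⟩⟩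

def unionι {X : TCM.{u}} (A B : Subobject X) : union A B ⟶ X :=
  ⟨Subtype.val, Subtype.val, fun _ => rfl⟩

instance {X : TCM.{u}} (A B : Subobject X) : Mono (unionι A B) :=
  mono_of_injective _ Subtype.val_injective Subtype.val_injective

theorem sup_le_mk_unionι {X : TCM.{u}} (A B : Subobject X) :
    A ⊔ B ≤ Subobject.mk (unionι A B) := by
  refine sup_le (Subobject.le_mk_of_comm ⟨fun x => ⟨_, .inl ⟨x, rfl⟩⟩,
      fun x => ⟨_, .inl ⟨x, rfl⟩⟩, fun x => Subtype.ext (A.arrow.comm x)⟩ rfl)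
    (Subobject.le_mk_of_comm ⟨fun x => ⟨_, .inr ⟨x, rfl⟩⟩,
      fun x => ⟨_, .inr ⟨x, rfl⟩⟩, fun x => Subtype.ext (B.arrow.comm x)⟩ rfl)

theorem factors_pointU_of_mem_range {X : TCM.{u}} {A : Subobject X} {x : X.U}
    (h : x ∈ Set.range A.arrow.onU) : A.Factors (pointU x) := by
  obtain ⟨a, rfl⟩ := h
  rw [← pointU_comp]
  exact Subobject.factors_comp_arrow _

theorem factors_pointV_of_mem_range {X : TCM.{u}} {A : Subobject X} {x : X.V}
    (h : x ∈ Set.range A.arrow.onV) : A.Factors (pointV x) := by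
  obtain ⟨a, rfl⟩ := h
  rw [← pointV_comp]
  exact Subobject.factors_comp_arrow _

/-- The join lies below the componentwise union, and an element of a union of sets belongs to one of
the two sets. -/
theorem factors_pointU_of_sup {X : TCM.{u}} {A B : Subobject X} {x : X.U}
    (h : (A ⊔ B).Factors (pointU x)) : A.Factors (pointU x) ∨ B.Factors (pointU x) := by
  obtain ⟨s, hs⟩ := Subobject.factors_of_le _ (sup_le_mk_unionι A B) h
  have hx : (s.onU PUnit.unit).1 = x := congrArg (fun k : one ⟶ X => k.onU PUnit.unit) hs
  have hmem : x ∈ Set.range A.arrow.onU ∪ Set.range B.arrow.onU :=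
    hx ▸ (s.onU PUnit.unit).2
  exact Or.imp factors_pointU_of_mem_range factors_pointU_of_mem_range hmem

theorem factors_pointV_of_sup {X : TCM.{u}} {A B : Subobject X} {x : X.V}
    (h : (A ⊔ B).Factors (pointV x)) : A.Factors (pointV x) ∨ B.Factors (pointV x) := by
  obtain ⟨s, hs⟩ := Subobject.factors_of_le _ (sup_le_mk_unionι A B) h
  have hx : (s.onV PUnit.unit).1 = x := congrArg (fun k : dot ⟶ X => k.onV PUnit.unit) hs
  have hmem : x ∈ Set.range A.arrow.onV ∪ Set.range B.arrow.onV :=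
    hx ▸ (s.onV PUnit.unit).2
  exact Or.imp factors_pointV_of_mem_range factors_pointV_of_mem_range hmem

theorem epi_coprod_desc_of_cover {N X : TCM.{u}} {A B : Subobject X} {a : N ⟶ X}
    (h : (A ⊔ B).Factors a) :
    Epi (coprod.desc ((Subobject.pullback a).obj A).arrow ((Subobject.pullback a).obj B).arrow) := by
  -- A stage that `a` sends into `A` or into `B` lifts to the matching summand; points always
  -- satisfy this alternative.
  have key : ∀ (T : TCM.{u}) (t : T ⟶ N), A.Factors (t ≫ a) ∨ B.Factors (t ≫ a) →
      ∃ s, s ≫ coprod.desc ((Subobject.pullback a).obj A).arrow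
        ((Subobject.pullback a).obj B).arrow = t := by
    rintro T t (ht | ht)
    · have := (pullback_factors_iff a A t).2 ht
      exact ⟨Subobject.factorThru _ t this ≫ coprod.inl, by
        rw [Category.assoc, coprod.inl_desc, Subobject.factorThru_arrow]⟩
    · have := (pullback_factors_iff a B t).2 ht
      exact ⟨Subobject.factorThru _ t this ≫ coprod.inr, by
        rw [Category.assoc, coprod.inr_desc, Subobject.factorThru_arrow]⟩
  refine epi_of_lift_points _ (fun x => key _ _ ?_) (fun x => key _ _ ?_)
  · rw [pointU_comp]
    exact factors_pointU_of_sup (pointU_comp a x ▸ Subobject.factors_of_factors_right _ h)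
  · rw [pointV_comp]
    exact factors_pointV_of_sup (pointV_comp a x ▸ Subobject.factors_of_factors_right _ h)

theorem sup_factors_iff {N X : TCM.{u}} (A B : Subobject X) (a : N ⟶ X) :
    (A ⊔ B).Factors a ↔ ∃ (O P : TCM.{u}) (p : O ⟶ N) (q : P ⟶ N),
      Epi (coprod.desc p q) ∧ A.Factors (p ≫ a) ∧ B.Factors (q ≫ a) := by
  constructor
  · intro h
    exact ⟨_, _, _, _, epi_coprod_desc_of_cover h,
      (pullback_factors_iff a A _).1 (Subobject.factors_self _),
      (pullback_factors_iff a B _).1 (Subobject.factors_self _)⟩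
  · rintro ⟨O, P, p, q, _, hp, hq⟩
    -- On `O ⨿ P` the two factorisations through the join glue by the universal property of the
    -- coproduct.
    rw [← factors_comp_iff_of_epi _ (coprod.desc p q)]
    have hp' := Subobject.sup_factors_of_factors_left (Y := B) hp
    have hq' := Subobject.sup_factors_of_factors_right (X := A) hq
    have : coprod.desc p q ≫ a = coprod.desc (Subobject.factorThru _ _ hp')
        (Subobject.factorThru _ _ hq') ≫ (A ⊔ B).arrow := by
      ext1 <;> simp
    rw [this]
    exact Subobject.factors_comp_arrow _

theorem imageSubobject_le_mk_rangeι {M X : TCM.{u}} (g : M ⟶ X) :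
    imageSubobject g ≤ Subobject.mk (rangeι g) :=
  imageSubobject_le_mk _ _ (rangeFactor g).e (rangeFactor g).fac

theorem imageSubobject_factors_iff {M N X : TCM.{u}} (g : M ⟶ X) (a : N ⟶ X) :
    (imageSubobject g).Factors a ↔
      ∃ (O : TCM.{u}) (p : O ⟶ N) (s : O ⟶ M), Epi p ∧ s ≫ g = p ≫ a := by
  constructor
  · intro h
    obtain ⟨r, hr⟩ := Subobject.factors_of_le _ (imageSubobject_le_mk_rangeι g) h
    -- The pullback of `g` along `a` covers `N`: each point of `N` lands in the range of `g`, and a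
    -- preimage in `M` lifts it.
    refine ⟨pullback g a, pullback.snd g a, pullback.fst g a,
      epi_of_lift_points _ (fun x => ?_) (fun x => ?_), pullback.condition⟩
    · obtain ⟨y, hy⟩ := (r.onU x).2
      have hx : (r.onU x).1 = a.onU x := congrArg (fun k : N ⟶ X => k.onU x) hr
      exact ⟨pullback.lift (pointU y) (pointU x) (by rw [pointU_comp, pointU_comp, hy, hx]),
        pullback.lift_snd _ _ _⟩
    · obtain ⟨y, hy⟩ := (r.onV x).2
      have hx : (r.onV x).1 = a.onV x := congrArg (fun k : N ⟶ X => k.onV x) hr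
      exact ⟨pullback.lift (pointV y) (pointV x) (by rw [pointV_comp, pointV_comp, hy, hx]),
        pullback.lift_snd _ _ _⟩
  · rintro ⟨O, p, s, _, h⟩
    rw [← factors_comp_iff_of_epi _ p, ← h]
    exact imageSubobject_factors_comp_self _ s

/-- The initial object is strict. -/
theorem nonempty_iso_initial_of_hom {O : TCM.{u}} (f : O ⟶ ⊥_ TCM.{u}) :
    Nonempty (O ≅ ⊥_ TCM.{u}) := by
  -- An arrow to the empty model forces both components of `O` to be empty.
  let z : O ⟶ zero := f ≫ initial.to zero
  refine ⟨⟨f, initial.to O, ?_, initialIsInitial.hom_ext _ _⟩⟩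
  ext x
  · exact (z.onU x).elim
  · exact (z.onV x).elim

theorem bot_factors_iff {O X : TCM.{u}} (a : O ⟶ X) :
    (⊥ : Subobject X).Factors a ↔ Nonempty (O ≅ ⊥_ TCM.{u}) := by
  constructor
  · exact fun h => nonempty_iso_initial_of_hom
      (Subobject.factorThru _ a h ≫ Subobject.botCoeIsoInitial.hom)
  · rintro ⟨i⟩
    have : a = (i.hom ≫ Subobject.botCoeIsoInitial.inv) ≫ (⊥ : Subobject X).arrow := by
      rw [← cancel_epi i.inv]
      exact initialIsInitial.hom_ext _ _
    rw [this]
    exact Subobject.factors_comp_arrow _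

/-! ### The logical operations at a stage -/

theorem isTrue_andΩ_iff {N : TCM.{u}} (f g : N ⟶ Omega) :
    IsTrue (lift f g ≫ andΩ) ↔ IsTrue f ∧ IsTrue g := by
  rw [andΩ, isTrue_comp_charSub_iff, Subobject.inf_factors, extension_factors_iff,
    extension_factors_iff, lift_fst, lift_snd]

theorem isTrue_orΩ_iff {N : TCM.{u}} (f g : N ⟶ Omega) :
    IsTrue (lift f g ≫ orΩ) ↔ ∃ (O P : TCM.{u}) (p : O ⟶ N) (q : P ⟶ N),
      Epi (coprod.desc p q) ∧ IsTrue (p ≫ f) ∧ IsTrue (q ≫ g) := by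
  simp only [orΩ, isTrue_comp_charSub_iff, sup_factors_iff, extension_factors_iff,
    Category.assoc, lift_fst, lift_snd]

/-- By definition of `impΩ` the left side says `f ∧ g = f`, and `omega_hom_ext` tests this equation
stage by stage. -/
theorem isTrue_impΩ_iff {N : TCM.{u}} (f g : N ⟶ Omega) :
    IsTrue (lift f g ≫ impΩ) ↔
      ∀ (O : TCM.{u}) (p : O ⟶ N), IsTrue (p ≫ f) → IsTrue (p ≫ g) := by
  have hand : ∀ (O : TCM.{u}) (p : O ⟶ N),
      IsTrue (p ≫ lift f g ≫ andΩ) ↔ IsTrue (p ≫ f) ∧ IsTrue (p ≫ g) := fun O p => by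
    rw [← Category.assoc, comp_lift, isTrue_andΩ_iff]
  rw [impΩ, isTrue_comp_charSub_iff, equalizerSubobject_factors_iff, lift_fst]
  constructor
  · intro h O p hp
    rw [← h] at hp
    exact ((hand O p).1 hp).2
  · intro h
    exact omega_hom_ext fun O p => (hand O p).trans (and_iff_left_of_imp (h O p))

theorem isTrue_falseΩ_iff {O : TCM.{u}} (t : O ⟶ 𝟙_ TCM) :
    IsTrue (t ≫ falseΩ) ↔ Nonempty (O ≅ ⊥_ TCM.{u}) := by
  rw [falseΩ, isTrue_comp_charSub_iff, bot_factors_iff]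

theorem isTrue_notΩ_iff {N : TCM.{u}} (f : N ⟶ Omega) :
    IsTrue (f ≫ notΩ) ↔
      ∀ (O : TCM.{u}) (p : O ⟶ N), IsTrue (p ≫ f) → Nonempty (O ≅ ⊥_ TCM.{u}) := by
  rw [notΩ, ← Category.assoc, comp_lift, Category.comp_id, isTrue_impΩ_iff]
  simp only [← Category.assoc _ _ falseΩ, isTrue_falseΩ_iff]

/-- The β-rule at generalized elements; it turns membership in a curried predicate into the
predicate itself. -/
theorem lift_curry_ev {B C L N : TCM.{u}} (f : C ⊗ L ⟶ B) (b : N ⟶ C) (a : N ⟶ L) :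
    lift b (a ≫ MonoidalClosed.curry f) ≫ (ihom.ev C).app B = lift b a ≫ f := by
  rw [← lift_whiskerLeft, Category.assoc, MonoidalClosed.whiskerLeft_curry_ihom_ev_app]

theorem isTrue_exΩ_iff {B L N : TCM.{u}} (f : B ⊗ L ⟶ Omega) (a : N ⟶ L) :
    IsTrue (a ≫ MonoidalClosed.curry f ≫ exΩ B) ↔
      ∃ (O : TCM.{u}) (p : O ⟶ N) (b : O ⟶ B), Epi p ∧ IsTrue (lift b (p ≫ a) ≫ f) := by
  rw [exΩ, ← Category.assoc, isTrue_comp_charSub_iff, imageSubobject_factors_iff]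
  refine exists_congr fun O => exists_congr fun p => ⟨?_, ?_⟩
  · rintro ⟨s, hp, hs⟩
    -- The lift `s` is a pair in the membership relation: its first coordinate is the witness, and
    -- by `hs` its second is the curried predicate.
    refine ⟨(s ≫ (extension (memΩ B)).arrow) ≫ fst _ _, hp, ?_⟩
    have h := (extension_factors_iff (memΩ B) _).1 (Subobject.factors_comp_arrow s)
    have e : s ≫ (extension (memΩ B)).arrow =
        lift ((s ≫ (extension (memΩ B)).arrow) ≫ fst _ _)
          ((p ≫ a) ≫ MonoidalClosed.curry f) := by
      apply CartesianMonoidalCategory.hom_ext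
      · simp
      · simp [hs]
    rw [← lift_curry_ev, ← e]
    exact h
  · rintro ⟨b, hp, hb⟩
    rw [← lift_curry_ev] at hb
    have h := (extension_factors_iff (memΩ B) _).2 hb
    refine ⟨Subobject.factorThru _ _ h, hp, ?_⟩
    rw [← Category.assoc, Subobject.factorThru_arrow, lift_snd, Category.assoc]

theorem isTrue_allΩ_iff {B L N : TCM.{u}} (f : B ⊗ L ⟶ Omega) (a : N ⟶ L) :
    IsTrue (a ≫ MonoidalClosed.curry f ≫ allΩ B) ↔
      ∀ (O : TCM.{u}) (p : O ⟶ N) (b : O ⟶ B), IsTrue (lift b (p ≫ a) ≫ f) := by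
  -- The curried predicate equals the name of the maximal subobject exactly when, uncurried, it is
  -- constantly true on `B ⊗ N`.
  have h : IsTrue (a ≫ MonoidalClosed.curry f ≫ allΩ B) ↔ IsTrue (B ◁ a ≫ f) := by
    have e : ∀ s : N ⟶ 𝟙_ TCM, B ◁ s ≫ toUnit (B ⊗ 𝟙_ TCM) ≫ trueΩ = toUnit _ ≫ trueΩ :=
      fun s => by rw [← Category.assoc, toUnit_unique (B ◁ s ≫ toUnit _) (toUnit _)]
    rw [allΩ, ← Category.assoc, isTrue_comp_char_iff]
    simp only [← MonoidalClosed.curry_natural_left, e]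
    exact ⟨fun ⟨_, hs⟩ => (MonoidalClosed.curry_injective hs).symm,
      fun h => ⟨toUnit N, congrArg _ h.symm⟩⟩
  rw [h]
  constructor
  · intro h O p b
    rw [← lift_whiskerLeft, Category.assoc]
    exact h.comp _
  · intro h
    -- The generic instance: the universal element of `B` over `N`.
    have := h (B ⊗ N) (snd _ _) (fst _ _)
    rwa [← lift_whiskerLeft, lift_fst_snd, Category.id_comp] at this

end TCM

/-! ### The forcing clauses -/

theorem forces_iff {N : TCM.{u}} {Γ : Ctx.{u}} (α : N ⟶ Γ.obj) (φ : Formula Γ) :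
    Forces α φ ↔ TCM.IsTrue (α ≫ φ.interp) :=
  TCM.extension_factors_iff _ _

theorem mainTheorem6 {N : TCM.{u}} {Γ : Ctx.{u}} (α : N ⟶ Γ.obj) :
    (∀ φ ψ : Formula Γ, Forces α (φ.and ψ) ↔ Forces α φ ∧ Forces α ψ) ∧
    (∀ φ ψ : Formula Γ, Forces α (φ.or ψ) ↔
      ∃ (O P : TCM.{u}) (p : O ⟶ N) (q : P ⟶ N),
        Epi (coprod.desc p q) ∧ Forces (p ≫ α) φ ∧ Forces (q ≫ α) ψ) ∧
    (∀ φ ψ : Formula Γ, Forces α (φ.imp ψ) ↔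
      ∀ (O : TCM.{u}) (p : O ⟶ N), Forces (p ≫ α) φ → Forces (p ≫ α) ψ) ∧
    (∀ φ : Formula Γ, Forces α φ.not ↔
      ∀ (O : TCM.{u}) (p : O ⟶ N), Forces (p ≫ α) φ → Nonempty (O ≅ ⊥_ TCM.{u})) ∧
    (∀ (Y : TCM.{u}) (φ : Formula (.cons Y Γ)), Forces α φ.ex ↔
      ∃ (O : TCM.{u}) (p : O ⟶ N) (β : O ⟶ Y),
        Epi p ∧ Forces (Γ := .cons Y Γ) (lift β (p ≫ α)) φ) ∧
    (∀ (Y : TCM.{u}) (φ : Formula (.cons Y Γ)), Forces α φ.all ↔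
      ∀ (O : TCM.{u}) (p : O ⟶ N) (β : O ⟶ Y),
        Forces (Γ := .cons Y Γ) (lift β (p ≫ α)) φ) := by
  refine ⟨fun φ ψ => ?_, fun φ ψ => ?_, fun φ ψ => ?_, fun φ => ?_, fun Y φ => ?_, fun Y φ => ?_⟩
  · simp only [forces_iff, Term.interp]
    rw [← Category.assoc, comp_lift, TCM.isTrue_andΩ_iff]
  · simp only [forces_iff, Term.interp, Category.assoc]
    rw [← Category.assoc, comp_lift, TCM.isTrue_orΩ_iff]
  · simp only [forces_iff, Term.interp, Category.assoc]
    rw [← Category.assoc, comp_lift, TCM.isTrue_impΩ_iff]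
  · simp only [forces_iff, Term.interp, Category.assoc]
    rw [← Category.assoc, TCM.isTrue_notΩ_iff]
  · simp only [forces_iff, Term.interp]
    exact (TCM.isTrue_exΩ_iff φ.interp α).trans (exists_congr fun O => exists_congr fun p =>
      exists_congr fun β => and_congr_right fun _ =>
        (forces_iff (Γ := .cons Y Γ) (lift β (p ≫ α)) φ).symm)
  · simp only [forces_iff, Term.interp]
    exact (TCM.isTrue_allΩ_iff φ.interp α).trans (forall_congr' fun O => forall_congr' fun p =>
      forall_congr' fun β => (forces_iff (Γ := .cons Y Γ) (lift β (p ≫ α)) φ).symm)
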